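/- All posets are finite. A poset $P$ is $(3+1)$-free if there are no $a<b<c$ and $d$ in $P$ with $d$ incomparable to each of $a,b,c$. Let $P$ be $(3+1)$-free, and write $D_a=\{x: x<a\}$, $U_a=\{x: x>a\}$. Two vertices are clones if they have the same $D_a$ and the same $U_a$. A top (respectively bottom) of a tangle is a connected component, with at least two vertices, of the graph on $P$ joining $a$ and $b$ when $D_a,D_b$ (respectively $U_a,U_b$) are incomparable under inclusion. A tangle is a pair $(A,B)$ of a top $A$ and a bottom $B$ such that there are $a,b\in A$ and $c,d\in B$ with $c<a$, $d<b$ and no other relations among $a,b,c,d$. A clone set is an equivalence class, under the relation of being clones, of the vertices which lie in no tangle. The parts of $P$ are its clone sets and its tangles. The levels of $P$ are $L_1$, the set of minimal vertices, and $L_{i+1}$, the set of minimal vertices of $P\setminus(L_1\cup\cdots\cup L_i)$; write $\ell(a)=i$ if $a\in L_i$. A compatible listing is a listing $(X_1,\dots,X_k)$ of all parts, without repetition, such that for $a\in X_i$, $b\in X_j$, $i\neq j$, we have $a<b$ exactly when $\ell(a)\le\ell(b)-2$, or $\ell(a)=\ell(b)-1$ and $i<j$. Let $\Sigma=\{c_1,c_2,\dots\}\cup\{t_{12},t_{23},\dots\}$,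 and let $M$ be the monoid generated by $\Sigma$ subject to the relations $c_ic_j=c_jc_i$ if $|i-j|\ge 2$; $c_it_{j\,j+1}=t_{j\,j+1}c_i$ if $i\le j-2$ or $i\ge j+3$; and $t_{i\,i+1}t_{j\,j+1}=t_{j\,j+1}t_{i\,i+1}$ if $|i-j|\ge 3$. The skeleton of $P$ is the element of $M$ represented by the word obtained from a compatible listing by replacing each clone set on level $i$ by $c_i$ and each tangle with bottom on level $i$ and top on level $i+1$ by $t_{i\,i+1}$. A decorated Dyck path is a path from $(0,0)$ to $(2n,0)$, for some $n\ge 0$, with (undecorated) up-steps $(1,1)$, decorated double up-steps $(2,2)$ and down-steps $(1,-1)$, which never goes below the $x$-axis. **Theorem.** There is a bijection between the set of skeleta of $(3+1)$-free posets and the set of decorated Dyck paths that do not contain three consecutive steps $(1,1),(1,-1),(1,1)$. It sends a skeleton $m\in M$ to the path obtained as follows from the word $w_0\in\Sigma^*$ that is the lexicographically maximal representative of $m$ with respect to the order $c_1<t_{12}<c_2<t_{23}<\cdots$ on $\Sigma$: replace each letter $c_i$ by a step $(1,1)$ ending at height $i$ and each letter $t_{i\,i+1}$ by a step $(2,2)$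 ending at height $i+1$, and insert down-steps $(1,-1)$ as necessary before these steps and at the end. -/

import Mathlib

/-! ### Finite posets: views, clones, tangles, parts -/

namespace ThreePlusOne

/-- `P` has no induced subposet which is the disjoint union of a chain of three vertices and
a single vertex. -/
def IsThreePlusOneFree (P : Type*) [PartialOrder P] : Prop :=
  ∀ a b c d : P, a < b → b < c →
    ¬ (IncompRel (· ≤ ·) d a ∧ IncompRel (· ≤ ·) d b ∧ IncompRel (· ≤ ·) d c)

/-- The view from `a`: its strict downset and the complement of its strict upset. -/
def view {P : Type*} [PartialOrder P] (a : P) : Set P × Set P :=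
  (Set.Iio a, (Set.Ioi a)ᶜ)

/-- Two vertices are clones when they have the same view. -/
def Clone {P : Type*} [PartialOrder P] (a b : P) : Prop :=
  view a = view b

/-- The graph on `P` whose edges join vertices with incomparable strict downsets. -/
def topGraph (P : Type*) [PartialOrder P] : SimpleGraph P where
  Adj a b := IncompRel (fun X Y : Set P => X ⊆ Y) (Set.Iio a) (Set.Iio b)
  symm := ⟨fun _ _ h => h.symm⟩
  loopless := ⟨fun _ h => h.1 subset_rfl⟩

/-- The graph on `P` whose edges join vertices with incomparable strict upsets. -/
def botGraph (P : Type*) [PartialOrder P] : SimpleGraph P where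
  Adj a b := IncompRel (fun X Y : Set P => X ⊆ Y) (Set.Ioi a) (Set.Ioi b)
  symm := ⟨fun _ _ h => h.symm⟩
  loopless := ⟨fun _ h => h.1 subset_rfl⟩

/-- `A` is the top of a tangle: a connected component, with at least two vertices, of the graph
of vertices with incomparable downsets. -/
def IsTangleTop {P : Type*} [PartialOrder P] (A : Set P) : Prop :=
  A.Nontrivial ∧ ∃ C : (topGraph P).ConnectedComponent, C.supp = A

/-- `B` is the bottom of a tangle. -/
def IsTangleBottom {P : Type*} [PartialOrder P] (B : Set P) : Prop :=
  B.Nontrivial ∧ ∃ C : (botGraph P).ConnectedComponent, C.supp = B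

/-- `a, b, c, d` form an induced `(2+2)` subposet with relations `c < a` and `d < b`, so that
`a, b` are its top vertices and `c, d` its bottom vertices. -/
def IsTwoPlusTwo {P : Type*} [PartialOrder P] (a b c d : P) : Prop :=
  c < a ∧ d < b ∧ IncompRel (· ≤ ·) a b ∧ IncompRel (· ≤ ·) c d ∧
    IncompRel (· ≤ ·) a d ∧ IncompRel (· ≤ ·) b c

/-- A tangle is a pair `(A, B)` of a top and a bottom of a tangle which are matched: some induced
`(2+2)` subposet has its top vertices in `A` and its bottom vertices in `B`. -/
def IsTangle {P : Type*} [PartialOrder P] (A B : Set P) : Prop :=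
  IsTangleTop A ∧ IsTangleBottom B ∧
    ∃ a ∈ A, ∃ b ∈ A, ∃ c ∈ B, ∃ d ∈ B, IsTwoPlusTwo a b c d

/-- The set of vertices which lie in some tangle. -/
def tangleVertices (P : Type*) [PartialOrder P] : Set P :=
  {x | ∃ A B : Set P, IsTangle A B ∧ x ∈ A ∪ B}

/-- A clone set is an equivalence class of vertices outside all tangles under the relation
of being clones. -/
def IsCloneSet {P : Type*} [PartialOrder P] (C : Set P) : Prop :=
  ∃ a, a ∉ tangleVertices P ∧ C = {b | b ∉ tangleVertices P ∧ Clone a b}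

/-- Candidates for the parts of a poset: a set of vertices (a clone set), or a pair of sets
of vertices (the top and the bottom of a tangle). -/
inductive Part (P : Type*) where
  | cloneSet (C : Set P) : Part P
  | tangle (A B : Set P) : Part P

/-- The parts of a poset are its clone sets and its tangles. -/
def Part.IsPart {P : Type*} [PartialOrder P] : Part P → Prop
  | .cloneSet C => IsCloneSet C
  | .tangle A B => IsTangle A B

/-- The vertices of a part. -/
def Part.vertices {P : Type*} : Part P → Set P
  | .cloneSet C => C
  | .tangle A B => A ∪ B

/-! ### Levels and compatible listings -/

/-- The union of the `n` lowest levels, which are removed successively: the minimal vertices, then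
the minimal vertices of what remains, and so on. -/
def lowestLevels (P : Type*) [PartialOrder P] : ℕ → Set P
  | 0 => ∅
  | n + 1 => lowestLevels P n ∪ {a | Minimal (fun x => x ∉ lowestLevels P n) a}

/-- The levels of a poset, numbered from `0`: in the usual numbering from `1` this is level
`L_{n+1}`, the set of minimal vertices of `P` without `L_1, …, L_n`. -/
def levelSet (P : Type*) [PartialOrder P] (n : ℕ) : Set P :=
  {a | Minimal (fun x => x ∉ lowestLevels P n) a}

/-- The number, counted from `0`, of the level on which a vertex of a finite poset lies. -/
noncomputable def level {P : Type*} [PartialOrder P] (a : P) : ℕ :=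
  sInf {n | a ∈ levelSet P n}

/-- A compatible listing of a poset: all parts are listed once each, and for vertices `a`, `b` in
different parts, the `i`-th and the `j`-th one, `a < b` holds exactly when `a` is at least
two levels below `b`, or exactly one level below `b` and `i < j`. -/
def IsCompatibleListing {P : Type*} [PartialOrder P] (L : List (Part P)) : Prop :=
  L.Nodup ∧ (∀ X, X ∈ L ↔ X.IsPart) ∧
    ∀ i j : Fin L.length, i ≠ j → ∀ a ∈ (L.get i).vertices, ∀ b ∈ (L.get j).vertices,
      (a < b ↔ level a + 2 ≤ level b ∨ (level a + 1 = level b ∧ i < j))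

/-! ### The partially commutative monoid and skeleta -/

/-- The alphabet. Indices are counted from `0`: `c i` is the letter written `c_{i+1}` in the usual
numbering from `1`, and `t i` is the letter written `t_{i+1,i+2}`. -/
inductive Letter where
  | c (i : ℕ) : Letter
  | t (i : ℕ) : Letter

/-- Position of a letter in the total order `c_1 < t_{12} < c_2 < t_{23} < ⋯`. -/
def Letter.rank : Letter → ℕ
  | .c i => 2 * i
  | .t i => 2 * i + 1

theorem Letter.rank_injective : Function.Injective Letter.rank := by
  rintro (i | i) (j | j) h <;> simp only [Letter.rank] at h <;> (congr 1; omega)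

/-- The total order `c_1 < t_{12} < c_2 < t_{23} < ⋯` on letters. -/
noncomputable instance : LinearOrder Letter :=
  LinearOrder.lift' Letter.rank Letter.rank_injective

/-- The defining relations of the partially commutative monoid. -/
inductive CommRel : FreeMonoid Letter → FreeMonoid Letter → Prop
  | cc (i j : ℕ) (h : i + 2 ≤ j ∨ j + 2 ≤ i) :
      CommRel (FreeMonoid.of (.c i) * FreeMonoid.of (.c j))
        (FreeMonoid.of (.c j) * FreeMonoid.of (.c i))
  | ct (i j : ℕ) (h : i + 2 ≤ j ∨ j + 3 ≤ i) :
      CommRel (FreeMonoid.of (.c i) * FreeMonoid.of (.t j))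
        (FreeMonoid.of (.t j) * FreeMonoid.of (.c i))
  | tt (i j : ℕ) (h : i + 3 ≤ j ∨ j + 3 ≤ i) :
      CommRel (FreeMonoid.of (.t i) * FreeMonoid.of (.t j))
        (FreeMonoid.of (.t j) * FreeMonoid.of (.t i))

/-- The free partially commuting monoid. -/
abbrev TraceMonoid : Type := PresentedMonoid CommRel

/-- The element of the free partially commuting monoid represented by a word. -/
def trace (w : List Letter) : TraceMonoid :=
  PresentedMonoid.mk CommRel (FreeMonoid.ofList w)

/-- The letter of a part: `c i` for a clone set on level `i`, and `t i` for a tangle with its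
bottom on level `i` and its top on level `i + 1`. -/
def Part.HasLetter {P : Type*} [PartialOrder P] : Part P → Letter → Prop
  | .cloneSet C, .c i => C ⊆ levelSet P i
  | .tangle A B, .t i => B ⊆ levelSet P i ∧ A ⊆ levelSet P (i + 1)
  | _, _ => False

/-- `m` is the skeleton of `P`: the element represented by the word of letters of the parts in a
compatible listing of `P`. -/
def IsSkeletonOf (P : Type*) [PartialOrder P] (m : TraceMonoid) : Prop :=
  ∃ (L : List (Part P)) (w : List Letter),
    IsCompatibleListing L ∧ List.Forall₂ Part.HasLetter L w ∧ trace w = m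

/-- The set of skeleta of finite `(3+1)`-free posets. -/
def skeleta : Set TraceMonoid :=
  {m | ∃ (P : Type) (_ : PartialOrder P) (_ : Finite P), IsThreePlusOneFree P ∧ IsSkeletonOf P m}

/-- `w` is the lexicographically maximal word representing `m`. -/
def IsLexMaxRepresentative (w : List Letter) (m : TraceMonoid) : Prop :=
  IsGreatest {u : List Letter | trace u = m} w

/-! ### Decorated Dyck paths -/

/-- Steps: undecorated up-steps, decorated double up-steps, and down-steps. -/
inductive Step where
  | up : Step
  | doubleUp : Step
  | down : Step

/-- The displacement of a step. -/
def Step.vec : Step → ℤ × ℤ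
  | .up => (1, 1)
  | .doubleUp => (2, 2)
  | .down => (1, -1)

/-- The point reached from `(0, 0)` by a sequence of steps. -/
def endpoint (p : List Step) : ℤ × ℤ :=
  (p.map Step.vec).sum

/-- A decorated Dyck path runs from `(0, 0)` to `(2n, 0)` for some `n ≥ 0` and never goes below the
horizontal axis. -/
def IsDecoratedDyckPath (p : List Step) : Prop :=
  (∀ q, q <+: p → 0 ≤ (endpoint q).2) ∧ ∃ n : ℕ, endpoint p = (2 * (n : ℤ), 0)

/-- The decorated Dyck paths without three consecutive steps up, down, up, all undecorated. -/
def dyckPaths : Set (List Step) :=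
  {p | IsDecoratedDyckPath p ∧ ¬ [Step.up, Step.down, Step.up] <:+: p}

/-- `Draws h w p`: starting at height `h`, the path `p` is obtained from the word `w` by replacing
the letter `c i` (`c_{i+1}` in the usual numbering) by an up-step from height `i` to height `i + 1`,
and the letter `t i` (`t_{i+1,i+2}` in the usual numbering) by a double up-step from height `i` to
height `i + 2`, and inserting before each of them, and at the end, the down-steps that lead to the
required height. The final height is `0`. -/
inductive Draws : ℕ → List Letter → List Step → Prop
  | nil (h : ℕ) : Draws h [] (List.replicate h .down)
  | c (i k : ℕ) (w : List Letter) (p : List Step) (hp : Draws (i + 1) w p) :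
      Draws (i + k) (.c i :: w) (List.replicate k .down ++ .up :: p)
  | t (i k : ℕ) (w : List Letter) (p : List Step) (hp : Draws (i + 2) w p) :
      Draws (i + k) (.t i :: w) (List.replicate k .down ++ .doubleUp :: p)

end ThreePlusOne

/-! A letter occupies the levels from `start` to `finish - 1`, and two letters are independent
exactly when the closed intervals [`start`, `finish`] are disjoint. Dependent letters are never
swapped, so words with the same trace have the same projection to every dependent pair; this is the
invariant of traces used throughout.

Two facts carry the bijection. First, a trace is a skeleton iff some representative is `Supported`
and `Separated` (`mem_skeleta_iff`): the words of compatible listings have both properties, and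
`Vertex w` realises any such word `w`. Second, the lexicographically maximal word of such a trace is
drawable from height 0 and has no factor c_i c_i (`Supported.drawable`, `Separated.not_adjacent`).
Conversely, a drawable word is maximal in its trace (`Drawable.isLexMaxRepresentative`); drawn from
height 0 it is supported, and without a factor c_i c_i it is separated. Drawable words correspond to
paths, with `readWord` as the inverse of `draw`, and factors c_i c_i become factors up, down, up. -/

namespace ThreePlusOne

/-! ### Independence of letters and invariants of traces. -/

/-- The lowest level met by a part with the given letter. -/
def Letter.start : Letter → ℕ
  | .c i => i
  | .t i => i

/-- One more than the highest level met by a part with the given letter. -/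
def Letter.finish : Letter → ℕ
  | .c i => i + 1
  | .t i => i + 2

/-- Two letters are dependent when they do not commute, or are equal. -/
def Letter.Dep (a b : Letter) : Prop :=
  a.start ≤ b.finish ∧ b.start ≤ a.finish

theorem Letter.dep_self (a : Letter) : a.Dep a := by
  cases a <;> simp [Letter.Dep, Letter.start, Letter.finish]

theorem Letter.start_lt_finish (a : Letter) : a.start < a.finish := by
  cases a <;> simp [Letter.start, Letter.finish]

theorem Letter.lt_iff_rank {a b : Letter} : a < b ↔ a.rank < b.rank := Iff.rfl

/-- On independent letters the alphabetical order is the order of their disjoint intervals. -/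
theorem Letter.finish_lt_start_of_lt {a b : Letter} (hlt : a < b) (h : ¬ a.Dep b) :
    a.finish < b.start := by
  rw [Letter.lt_iff_rank] at hlt
  cases a <;> cases b <;> simp only [Letter.Dep, Letter.start, Letter.finish, Letter.rank] at * <;>
    omega

theorem Letter.lt_of_finish_lt_start {a b : Letter} (h : a.finish < b.start) : a < b := by
  rw [Letter.lt_iff_rank]
  cases a <;> cases b <;> simp only [Letter.start, Letter.finish, Letter.rank] at * <;> omega

theorem CommRel.exists_not_dep {u v : FreeMonoid Letter} (h : CommRel u v) :
    ∃ a b : Letter, ¬ a.Dep b ∧ u = FreeMonoid.of a * FreeMonoid.of b ∧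
      v = FreeMonoid.of b * FreeMonoid.of a := by
  cases h with
  | cc i j h => exact ⟨_, _, by simp only [Letter.Dep, Letter.start, Letter.finish]; omega, rfl, rfl⟩
  | ct i j h => exact ⟨_, _, by simp only [Letter.Dep, Letter.start, Letter.finish]; omega, rfl, rfl⟩
  | tt i j h => exact ⟨_, _, by simp only [Letter.Dep, Letter.start, Letter.finish]; omega, rfl, rfl⟩

theorem trace_append (u v : List Letter) : trace (u ++ v) = trace u * trace v := by
  simp [trace, FreeMonoid.ofList_append]

theorem trace_pair_comm {a b : Letter} (h : ¬ a.Dep b) : trace [a, b] = trace [b, a] := by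
  have key : ∀ {u v : FreeMonoid Letter}, CommRel u v →
      PresentedMonoid.mk CommRel u = PresentedMonoid.mk CommRel v :=
    fun h => Quotient.sound (ConGen.Rel.of _ _ h)
  cases a with
  | c i =>
    cases b with
    | c j =>
      simp only [Letter.Dep, Letter.start, Letter.finish] at h
      exact key (CommRel.cc i j (by omega))
    | t j =>
      simp only [Letter.Dep, Letter.start, Letter.finish] at h
      exact key (CommRel.ct i j (by omega))
  | t i =>
    cases b with
    | c j =>
      simp only [Letter.Dep, Letter.start, Letter.finish] at h
      exact (key (CommRel.ct j i (by omega))).symm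
    | t j =>
      simp only [Letter.Dep, Letter.start, Letter.finish] at h
      exact key (CommRel.tt i j (by omega))

/-- The projection of a word to the letters `a` and `b`. -/
noncomputable def project (a b : Letter) (w : List Letter) : List Letter :=
  w.filter fun z => z = a ∨ z = b

theorem project_append (a b : Letter) (u v : List Letter) :
    project a b (u ++ v) = project a b u ++ project a b v :=
  List.filter_append ..

theorem project_cons_right (a b : Letter) (w : List Letter) :
    project a b (b :: w) = b :: project a b w := by
  simp [project]

/-- Words representing the same trace have equal projections to each pair of dependent letters. -/
theorem project_eq_of_trace_eq {a b : Letter} (hab : a.Dep b) {u v : List Letter}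
    (h : trace u = trace v) : project a b u = project a b v := by
  -- Erasing all other letters is a homomorphism that respects the relations: since `a` and `b` are
  -- dependent, at most one letter of a commuting pair survives.
  let f : Letter → FreeMonoid Letter := fun z => if z = a ∨ z = b then FreeMonoid.of z else 1
  have hf : ∀ x y, CommRel x y → FreeMonoid.lift f x = FreeMonoid.lift f y := by
    intro x y hxy
    obtain ⟨p, q, hpq, rfl, rfl⟩ := hxy.exists_not_dep
    simp only [map_mul, FreeMonoid.lift_eval_of, f]
    split_ifs with h1 h2 h2
    · exfalso
      rcases h1 with rfl | rfl <;> rcases h2 with rfl | rfl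
      · exact hpq (Letter.dep_self _)
      · exact hpq hab
      · exact hpq hab.symm
      · exact hpq (Letter.dep_self _)
    all_goals simp
  have key : ∀ w : List Letter, FreeMonoid.lift f (FreeMonoid.ofList w) =
      FreeMonoid.ofList (project a b w) := by
    intro w
    induction w with
    | nil => simp [project]
    | cons z w ih =>
      rw [FreeMonoid.ofList_cons, map_mul, ih, FreeMonoid.lift_eval_of]
      by_cases hz : z = a ∨ z = b
      · simp [f, project, hz, FreeMonoid.ofList_cons]
      · simp [f, project, hz]
  have h2 := congrArg (PresentedMonoid.lift f hf) h
  have e : ∀ w, PresentedMonoid.lift f hf (trace w) = FreeMonoid.ofList (project a b w) :=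
    fun w => key w
  rw [e, e] at h2
  exact FreeMonoid.ofList.injective h2

theorem count_eq_of_trace_eq {u v : List Letter} (h : trace u = trace v) (a : Letter) :
    u.count a = v.count a := by
  have h1 := congrArg (List.count a) (project_eq_of_trace_eq a.dep_self h)
  simpa [project, List.count_filter] using h1

/-- Representatives of one trace are permutations of each other, hence finite in number. -/
theorem exists_isLexMaxRepresentative (w : List Letter) :
    ∃ w₀, IsLexMaxRepresentative w₀ (trace w) := by
  have hfin : {u : List Letter | trace u = trace w}.Finite := by
    refine (List.finite_toSet w.permutations).subset fun u hu => ?_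
    exact List.mem_permutations.2 (List.perm_iff_count.2 (count_eq_of_trace_eq hu))
  obtain ⟨w₀, h₀, hmax⟩ := Set.exists_max_image _ id hfin ⟨w, rfl⟩
  exact ⟨w₀, h₀, hmax⟩

/-- Adjacent letters of a lexicographically maximal word allow to draw the second after the first
with down-steps only between them. -/
theorem start_le_finish_of_isLexMax {m : TraceMonoid} {u v : List Letter} {x y : Letter}
    (h : IsLexMaxRepresentative (u ++ x :: y :: v) m) : y.start ≤ x.finish := by
  by_contra! hlt
  have hcomm : trace (u ++ y :: x :: v) = m := by
    rw [← h.1]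
    have e : ∀ a b : Letter, u ++ a :: b :: v = u ++ ([a, b] ++ v) := fun _ _ => rfl
    simp only [e, trace_append]
    rw [trace_pair_comm (a := x) (b := y) fun hd => absurd hd.2 (by omega)]
  have hle := h.2 hcomm
  refine absurd hle (not_le.2 ?_)
  exact List.Lex.append_left _ (List.Lex.rel (Letter.lt_of_finish_lt_start hlt)) u

/-! ### Drawable words and lexicographic maximality. -/

/-- A word that can be drawn from height `h` with only down-steps inserted. -/
def Drawable : ℕ → List Letter → Prop
  | _, [] => True
  | h, x :: w => x.start ≤ h ∧ Drawable x.finish w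

/-- A path cannot climb past the interval of `y` without meeting it. For the first letter `z`,
induction gives `y.start ≤ z.finish`; independence then forces `y.finish < z.start ≤ h`. -/
theorem Drawable.start_le_of_append {v₁ v₂ : List Letter} {y : Letter} {h : ℕ}
    (hd : Drawable h (v₁ ++ y :: v₂)) (hdep : ∀ z ∈ v₁, ¬ z.Dep y) : y.start ≤ h := by
  induction v₁ generalizing h with
  | nil => exact hd.1
  | cons z v₁ ih =>
    have h1 := ih hd.2 fun z hz => hdep z (by simp [hz])
    have h2 := hdep z (by simp)
    have h3 := hd.1
    have := z.start_lt_finish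
    have := y.start_lt_finish
    simp only [Letter.Dep] at h2
    omega

theorem Drawable.drop {u v : List Letter} {h : ℕ} (hd : Drawable h (u ++ v)) :
    ∃ h', Drawable h' v := by
  induction u generalizing h with
  | nil => exact ⟨h, hd⟩
  | cons x u ih => exact ih hd.2

/-- Moving a letter to the front of a word: it commutes with everything before its first
occurrence. -/
theorem exists_first_occurrence {w v : List Letter} {y : Letter}
    (h : ∀ a b : Letter, a.Dep b → project a b w = project a b (y :: v)) :
    ∃ v₁ v₂, w = v₁ ++ y :: v₂ ∧ ∀ z ∈ v₁, z ≠ y ∧ ¬ z.Dep y := by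
  have hy : y ∈ w := by
    have : y ∈ project y y w := by rw [h y y y.dep_self]; simp [project]
    exact (List.mem_filter.1 this).1
  obtain ⟨v₁, v₂, hw, hv₁⟩ := List.eq_append_cons_of_mem hy
  refine ⟨v₁, v₂, hw, fun z hz => ⟨fun hzy => hv₁ (hzy ▸ hz), fun hdep => ?_⟩⟩
  -- If a letter `z` before the first `y` depended on `y`, the projection to `z` and `y` would not
  -- begin with `y`.
  have hp := h z y hdep
  rw [hw, project_append, project_cons_right, project_cons_right] at hp
  have hz' : z ∈ project z y v₁ := by simp [project, hz]
  cases hl : project z y v₁ with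
  | nil => simp [hl] at hz'
  | cons a l =>
    rw [hl] at hp
    have ha : a ∈ project z y v₁ := by simp [hl]
    rw [(List.cons.inj hp).1] at ha
    exact hv₁ (List.mem_filter.1 ha).1

/-- Suppose that at the first difference `w` has `x` and `w'` has a larger `y`. Then `y` occurs
later in `w`, after letters independent of it, one of which is `x`; so `x.finish < y.start`, and the
path would have to jump from `x` up to `y`. -/
theorem Drawable.not_lt {w w' : List Letter} {h : ℕ} (hd : Drawable h w)
    (hp : ∀ a b : Letter, a.Dep b → project a b w = project a b w') : ¬ w < w' := by
  intro hlt
  have hlt' : List.Lex (· < ·) w w' := hlt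
  clear hlt
  induction hlt' generalizing h with
  | nil =>
    rename_i y _
    have := hp y y y.dep_self
    simp [project] at this
  | cons _ ih =>
    refine ih hd.2 fun a b hab => ?_
    have := hp a b hab
    simp only [project, List.filter_cons] at this ⊢
    split_ifs at this
    · exact (List.cons.inj this).2
    · exact this
  | rel hxy =>
    rename_i x u y v
    obtain ⟨v₁, v₂, hw, hdep⟩ := exists_first_occurrence hp
    cases v₁ with
    | nil => exact hxy.ne (List.cons.inj hw).1
    | cons z v₁ =>
      obtain ⟨rfl, rfl⟩ := List.cons.inj hw
      have h1 := Letter.finish_lt_start_of_lt hxy (hdep x (by simp)).2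
      have := Drawable.start_le_of_append hd.2 fun z hz => (hdep z (by simp [hz])).2
      omega

theorem Drawable.isLexMaxRepresentative {w : List Letter} {h : ℕ} (hd : Drawable h w) :
    IsLexMaxRepresentative w (trace w) :=
  ⟨rfl, fun _ hu => _root_.not_lt.1 <| hd.not_lt fun _ _ hab => project_eq_of_trace_eq hab hu.symm⟩

/-! ### Supported and separated words. -/

/-- Every letter which does not start at the lowest level is preceded by a letter meeting the level
below its start. -/
def Supported (w : List Letter) : Prop :=
  ∀ (u v : List Letter) (y : Letter) (s : ℕ), w = u ++ y :: v → y.start = s + 1 →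
    ∃ z ∈ u, z.start ≤ s ∧ s < z.finish

/-- Between two successive occurrences of the letter `c i` there is a letter that does not commute
with it. -/
def Separated (w : List Letter) : Prop :=
  ∀ (u v x : List Letter) (i : ℕ), w = u ++ .c i :: (v ++ .c i :: x) → .c i ∉ v →
    ∃ z ∈ v, z.Dep (.c i)

/-- The letter supporting `y` depends on `y`, so it would prevent `y` from moving to the front. -/
theorem Supported.start_eq_zero {w v : List Letter} {y : Letter} (hw : Supported w)
    (h : trace w = trace (y :: v)) : y.start = 0 := by
  obtain ⟨v₁, v₂, rfl, hdep⟩ := exists_first_occurrence fun a b hab => project_eq_of_trace_eq hab h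
  by_contra hne
  obtain ⟨s, hs⟩ := Nat.exists_eq_succ_of_ne_zero hne
  obtain ⟨z, hz, h1, h2⟩ := hw v₁ v₂ y s rfl hs
  have := y.start_lt_finish
  exact (hdep z hz).2 ⟨by omega, by omega⟩

/-- Two successive occurrences of `a` are located by the number of earlier ones, which identifies
them across words with equal projections. -/
theorem exists_split_of_count {α : Type*} [DecidableEq α] {a : α} {w : List α} {n : ℕ}
    (h : n + 2 ≤ w.count a) :
    ∃ u v x, w = u ++ a :: (v ++ a :: x) ∧ u.count a = n ∧ a ∉ v := by
  induction w generalizing n with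
  | nil => simp at h
  | cons b w ih =>
    by_cases hb : b = a
    · subst hb
      rw [List.count_cons_self] at h
      cases n with
      | zero =>
        obtain ⟨v, x, rfl, hv⟩ := List.eq_append_cons_of_mem
          (List.count_pos_iff.1 (by omega : 0 < w.count b))
        exact ⟨[], v, x, rfl, rfl, hv⟩
      | succ n =>
        obtain ⟨u, v, x, rfl, hu, hv⟩ := ih (by omega : n + 2 ≤ w.count b)
        exact ⟨b :: u, v, x, rfl, by simp [hu], hv⟩
    · rw [List.count_cons_of_ne hb] at h
      obtain ⟨u, v, x, rfl, hu, hv⟩ := ih h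
      exact ⟨b :: u, v, x, rfl, by rw [List.count_cons_of_ne hb, hu], hv⟩

theorem eq_nil_of_split_eq {α : Type*} [DecidableEq α] {a : α} {u v x u' x' : List α}
    (h : u ++ a :: (v ++ a :: x) = u' ++ a :: a :: x') (hc : u.count a = u'.count a)
    (hv : a ∉ v) : v = [] := by
  induction u generalizing u' with
  | nil =>
    cases u' with
    | nil =>
      cases v with
      | nil => rfl
      | cons b v => simp at h hv; exact absurd h.1.symm hv.1
    | cons b u' =>
      obtain ⟨rfl, -⟩ := List.cons.inj h
      simp at hc
  | cons b u ih =>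
    cases u' with
    | nil =>
      obtain ⟨rfl, -⟩ := List.cons.inj h
      simp at hc
    | cons b' u' =>
      obtain ⟨rfl, h'⟩ := List.cons.inj h
      refine ih h' ?_
      simpa [List.count_cons] using hc

/-- The corresponding two occurrences of c_i in `w` have a dependent `z` between them, and the
projection to `z` and c_i keeps it there. -/
theorem Separated.not_adjacent {w u v : List Letter} {i : ℕ} (hw : Separated w) :
    trace w ≠ trace (u ++ .c i :: .c i :: v) := by
  intro h
  have hc : u.count (.c i) + 2 ≤ w.count (.c i) := by
    rw [count_eq_of_trace_eq h]
    simp only [List.count_append, List.count_cons_self]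
    omega
  obtain ⟨u', v', x, rfl, hu, hv⟩ := exists_split_of_count hc
  obtain ⟨z, hz, hdep⟩ := hw u' v' x i rfl hv
  have hp := project_eq_of_trace_eq hdep h
  simp only [project_append, project_cons_right] at hp
  have := eq_nil_of_split_eq hp (by simpa [project, List.count_filter] using hu)
    fun hmem => hv (List.mem_filter.1 hmem).1
  have hz' : z ∈ project z (.c i) v' := by simp [project, hz]
  simp [this] at hz'

/-- The lexicographically maximal representative of the trace of a supported word is drawable. -/
theorem Supported.drawable {w w₀ : List Letter} (hw : Supported w)
    (h : IsLexMaxRepresentative w₀ (trace w)) : Drawable 0 w₀ := by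
  -- Maximality controls every pair of adjacent letters; support is needed only for the first
  -- letter.
  have key : ∀ (v u : List Letter) (y : Letter),
      IsLexMaxRepresentative (u ++ y :: v) (trace w) → Drawable y.finish v := by
    intro v
    induction v with
    | nil => intros; trivial
    | cons x v ih =>
      intro u y h
      exact ⟨start_le_finish_of_isLexMax h, ih (u ++ [y]) x (by simpa using h)⟩
  cases w₀ with
  | nil => trivial
  | cons y v =>
    have h0 : trace (y :: v) = trace w := h.1
    exact ⟨(hw.start_eq_zero h0.symm).le, key v [] y h⟩

/-- All levels below the current height have been met when a word is drawn. -/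
theorem Drawable.supported {w : List Letter} (hd : Drawable 0 w) : Supported w := by
  -- Here `p` is the part already drawn, with the invariant that its letters meet every level below
  -- the current height `h`.
  have key : ∀ (u : List Letter) (h : ℕ) (p v : List Letter) (y : Letter) (s : ℕ),
      Drawable h (u ++ y :: v) → (∀ r < h, ∃ z ∈ p, z.start ≤ r ∧ r < z.finish) →
      y.start = s + 1 → ∃ z ∈ p ++ u, z.start ≤ s ∧ s < z.finish := by
    intro u
    induction u with
    | nil =>
      intro h p v y s hd hp hs
      have := hd.1
      simpa using hp s (by omega)
    | cons x u ih =>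
      intro h p v y s hd hp hs
      have := ih x.finish (p ++ [x]) v y s hd.2 (fun r hr => ?_) hs
      · simpa using this
      · by_cases hx : x.start ≤ r
        · exact ⟨x, by simp, hx, hr⟩
        · have := hd.1
          obtain ⟨z, hz, hz'⟩ := hp r (by omega)
          exact ⟨z, by simp [hz], hz'⟩
  rintro u v y s rfl hs
  simpa using key u 0 [] v y s hd (by simp) hs

/-- If all letters between two c_i were independent of c_i, the first of them, `z`, would lie below
c_i, as it is drawn from height `i + 1`; but the climb back to c_i requires `i ≤ z.finish`. -/
theorem Drawable.separated {w : List Letter} {h : ℕ} (hd : Drawable h w)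
    (hcc : ∀ u v i, w ≠ u ++ .c i :: .c i :: v) : Separated w := by
  rintro u v x i rfl hv
  by_contra! hdep
  obtain ⟨h', hd'⟩ := hd.drop
  cases v with
  | nil => exact hcc u x i rfl
  | cons z v =>
    have h1 := hd'.2.1
    have h2 := Drawable.start_le_of_append hd'.2.2 fun z hz => hdep z (by simp [hz])
    have h3 := hdep z (by simp)
    have := z.start_lt_finish
    simp only [Letter.Dep, Letter.start, Letter.finish] at *
    omega

end ThreePlusOne

namespace ThreePlusOne

/-! ### Drawable words as decorated Dyck paths. -/

/-- The step drawn for a letter. -/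
def Letter.step : Letter → Step
  | .c _ => .up
  | .t _ => .doubleUp

/-- The path drawn for a word from height `h`. -/
def draw : ℕ → List Letter → List Step
  | h, [] => List.replicate h .down
  | h, x :: w => List.replicate (h - x.start) .down ++ x.step :: draw x.finish w

/-- The word read off a path that starts at height `h`. -/
def readWord : ℕ → List Step → List Letter
  | _, [] => []
  | h, .up :: p => .c h :: readWord (h + 1) p
  | h, .doubleUp :: p => .t h :: readWord (h + 2) p
  | h, .down :: p => readWord (h - 1) p

theorem Drawable.draws {w : List Letter} {h : ℕ} (hd : Drawable h w) : Draws h w (draw h w) := by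
  induction w generalizing h with
  | nil => exact Draws.nil h
  | cons x w ih =>
    obtain ⟨hx, hd⟩ := hd
    obtain ⟨k, rfl⟩ := Nat.exists_eq_add_of_le hx
    rw [draw, Nat.add_sub_cancel_left]
    cases x with
    | c i => exact Draws.c i k w _ (ih hd)
    | t i => exact Draws.t i k w _ (ih hd)

theorem Draws.drawable {w : List Letter} {h : ℕ} {p : List Step} (hd : Draws h w p) :
    Drawable h w := by
  induction hd with
  | nil => trivial
  | c i k w p _ ih => exact ⟨Nat.le_add_right i k, ih⟩
  | t i k w p _ ih => exact ⟨Nat.le_add_right i k, ih⟩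

theorem Draws.eq_draw {w : List Letter} {h : ℕ} {p : List Step} (hd : Draws h w p) :
    p = draw h w := by
  induction hd with
  | nil => rfl
  | c i k w p _ ih => simp [draw, Letter.start, Letter.finish, Letter.step, ← ih]
  | t i k w p _ ih => simp [draw, Letter.start, Letter.finish, Letter.step, ← ih]

theorem readWord_replicate_down_append (h k : ℕ) (p : List Step) :
    readWord h (List.replicate k .down ++ p) = readWord (h - k) p := by
  induction k generalizing h with
  | zero => rfl
  | succ k ih => rw [List.replicate_succ, List.cons_append, readWord, ih, Nat.sub_sub, Nat.add_comm]

theorem Draws.readWord_eq {w : List Letter} {h : ℕ} {p : List Step} (hd : Draws h w p) :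
    readWord h p = w := by
  induction hd with
  | nil h => simpa [readWord] using readWord_replicate_down_append h h []
  | c i k w p _ ih =>
    rw [readWord_replicate_down_append, Nat.add_sub_cancel, readWord, ih]
  | t i k w p _ ih =>
    rw [readWord_replicate_down_append, Nat.add_sub_cancel, readWord, ih]

theorem Draws.down {w : List Letter} {h : ℕ} {p : List Step} (hd : Draws h w p) :
    Draws (h + 1) w (.down :: p) := by
  cases hd with
  | nil => exact Draws.nil (h + 1)
  | c i k w p hp => exact Draws.c i (k + 1) w p hp
  | t i k w p hp => exact Draws.t i (k + 1) w p hp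

/-- A path that starts at height `h`, ends at height `0` and never goes below height `0`. -/
def DyckFrom : ℕ → List Step → Prop
  | h, [] => h = 0
  | h, .up :: p => DyckFrom (h + 1) p
  | h, .doubleUp :: p => DyckFrom (h + 2) p
  | 0, .down :: _ => False
  | h + 1, .down :: p => DyckFrom h p

theorem DyckFrom.draws {p : List Step} {h : ℕ} (hp : DyckFrom h p) :
    Draws h (readWord h p) p := by
  induction p generalizing h with
  | nil => obtain rfl : h = 0 := hp; exact Draws.nil 0
  | cons s p ih =>
    cases s with
    | up => exact Draws.c h 0 _ _ (ih hp)
    | doubleUp => exact Draws.t h 0 _ _ (ih hp)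
    | down =>
      cases h with
      | zero => exact hp.elim
      | succ h => exact (ih hp).down

theorem dyckFrom_replicate_append {p : List Step} {h : ℕ} (k : ℕ) (hp : DyckFrom h p) :
    DyckFrom (h + k) (List.replicate k .down ++ p) := by
  induction k with
  | zero => exact hp
  | succ k ih => exact ih

theorem Draws.dyckFrom {w : List Letter} {h : ℕ} {p : List Step} (hd : Draws h w p) :
    DyckFrom h p := by
  induction hd with
  | nil h =>
    have : DyckFrom 0 [] := rfl
    simpa using dyckFrom_replicate_append h this
  | c i k w p _ ih => exact dyckFrom_replicate_append k (p := .up :: p) ih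
  | t i k w p _ ih => exact dyckFrom_replicate_append k (p := .doubleUp :: p) ih

theorem endpoint_cons (s : Step) (p : List Step) : endpoint (s :: p) = s.vec + endpoint p := by
  simp [endpoint]

/-- Here `n` counts the down-steps. A path ending at height 0 therefore has even length, so only the
height has to be tracked. -/
theorem exists_endpoint_fst_eq (p : List Step) :
    ∃ n : ℕ, (endpoint p).1 = (endpoint p).2 + 2 * n := by
  induction p with
  | nil => exact ⟨0, rfl⟩
  | cons s p ih =>
    obtain ⟨n, hn⟩ := ih
    rw [endpoint_cons]
    cases s with
    | up => exact ⟨n, by simp [Step.vec, hn]; ring⟩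
    | doubleUp => exact ⟨n, by simp [Step.vec, hn]; ring⟩
    | down => exact ⟨n + 1, by simp [Step.vec, hn]; ring⟩

theorem dyckFrom_iff {p : List Step} {h : ℕ} :
    DyckFrom h p ↔ (∀ q, q <+: p → 0 ≤ h + (endpoint q).2) ∧ h + (endpoint p).2 = 0 := by
  have cons_iff : ∀ (h : ℕ) (s : Step) (p : List Step),
      ((∀ q, q <+: s :: p → 0 ≤ h + (endpoint q).2) ∧ h + (endpoint (s :: p)).2 = 0) ↔
        (∀ q, q <+: p → 0 ≤ h + s.vec.2 + (endpoint q).2) ∧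
          h + s.vec.2 + (endpoint p).2 = 0 := by
    intro h s p
    simp only [List.prefix_cons_iff, endpoint_cons, Prod.snd_add, add_assoc]
    refine and_congr_left fun _ => ⟨fun H q hq => ?_, fun H q hq => ?_⟩
    · simpa [endpoint_cons] using H _ (.inr ⟨q, rfl, hq⟩)
    · rcases hq with rfl | ⟨q, rfl, hq⟩
      · simp [endpoint]
      · simpa [endpoint_cons] using H q hq
  induction p generalizing h with
  | nil => simp [DyckFrom, endpoint]
  | cons s p ih =>
    rw [cons_iff]
    cases s with
    | up => exact (ih (h := h + 1)).trans (by simp [Step.vec])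
    | doubleUp => exact (ih (h := h + 2)).trans (by simp [Step.vec])
    | down =>
      cases h with
      | zero =>
        simp only [DyckFrom, false_iff]
        rintro ⟨H, -⟩
        simpa [Step.vec, endpoint] using H [] List.nil_prefix
      | succ h => exact (ih (h := h)).trans (by simp [Step.vec])

theorem isDecoratedDyckPath_iff {p : List Step} : IsDecoratedDyckPath p ↔ DyckFrom 0 p := by
  rw [dyckFrom_iff, IsDecoratedDyckPath]
  simp only [Nat.cast_zero, zero_add]
  refine and_congr_right fun _ => ⟨fun ⟨n, hn⟩ => by rw [hn], fun h0 => ?_⟩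
  obtain ⟨n, hn⟩ := exists_endpoint_fst_eq p
  exact ⟨n, Prod.ext (by simp [hn, h0]) h0⟩

theorem exists_readWord_append (h : ℕ) (p : List Step) :
    ∃ h', ∀ q, readWord h (p ++ q) = readWord h p ++ readWord h' q := by
  induction p generalizing h with
  | nil => exact ⟨h, fun _ => rfl⟩
  | cons s p ih =>
    cases s with
    | up => obtain ⟨h', H⟩ := ih (h + 1); exact ⟨h', fun q => by simp [readWord, H]⟩
    | doubleUp => obtain ⟨h', H⟩ := ih (h + 2); exact ⟨h', fun q => by simp [readWord, H]⟩
    | down => obtain ⟨h', H⟩ := ih (h - 1); exact ⟨h', fun q => by simp [readWord, H]⟩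

/-- A drawn path contains up, down, up exactly when the word has a repeated letter `c i`. -/
theorem Draws.up_down_up_iff {w : List Letter} {h : ℕ} {p : List Step} (hd : Draws h w p) :
    [Step.up, .down, .up] <:+: p ↔ ∃ u v i, w = u ++ .c i :: .c i :: v := by
  constructor
  · rintro ⟨a, b, rfl⟩
    obtain ⟨h', H⟩ := exists_readWord_append h a
    -- With `h'` the height before the factor, both of its up-steps start at `h'` and are read as c
    -- `h'`.
    refine ⟨readWord h a, readWord (h' + 1) b, h', ?_⟩
    rw [← hd.readWord_eq, List.append_assoc, H]
    rfl
  · rintro ⟨u, v, i, rfl⟩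
    rw [hd.eq_draw]
    clear hd
    induction u generalizing h with
    | nil =>
      refine ⟨List.replicate (h - i) .down, draw (i + 1) v, ?_⟩
      simp [draw, Letter.start, Letter.finish, Letter.step]
    | cons x u ih =>
      exact (ih (h := x.finish)).trans
        ((List.suffix_cons _ _).isInfix.trans (List.suffix_append _ _).isInfix)

end ThreePlusOne

namespace ThreePlusOne

/-! ### The level function of a finite poset. -/

section Levels

variable {P : Type*} [PartialOrder P] {f : P → ℕ}

/-- A function is the level function when it is strictly monotone and every vertex of positive
value is above a vertex whose value is one less. -/
def IsLevelFunction (f : P → ℕ) : Prop :=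
  StrictMono f ∧ ∀ b n, f b = n + 1 → ∃ a, a < b ∧ f a = n

theorem IsLevelFunction.exists_lt (hf : IsLevelFunction f) {b : P} {n : ℕ} (h : n < f b) :
    ∃ a, a < b ∧ f a = n := by
  induction hk : f b using Nat.strong_induction_on generalizing b with
  | _ k ih =>
    obtain ⟨a, hab, ha⟩ := hf.2 b (f b - 1) (by omega)
    rcases Nat.lt_or_ge n (f a) with h1 | h1
    · obtain ⟨c, hca, hc⟩ := ih (f a) (by omega) h1 rfl
      exact ⟨c, hca.trans hab, hc⟩
    · exact ⟨a, hab, by omega⟩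

theorem IsLevelFunction.minimal_iff (hf : IsLevelFunction f) (n : ℕ) (a : P) :
    Minimal (fun x => x ∉ {x | f x < n}) a ↔ f a = n := by
  simp only [minimal_iff_forall_lt, Set.mem_ofPred_eq, not_lt, not_le]
  constructor
  · rintro ⟨h1, h2⟩
    refine le_antisymm (not_lt.1 fun hlt => ?_) h1
    obtain ⟨b, hba, hb⟩ := hf.exists_lt hlt
    exact absurd (h2 hba) (by omega)
  · rintro rfl
    exact ⟨le_rfl, fun b hb => hf.1 hb⟩

theorem IsLevelFunction.lowestLevels_eq (hf : IsLevelFunction f) (n : ℕ) :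
    lowestLevels P n = {x | f x < n} := by
  induction n with
  | zero => simp [lowestLevels]
  | succ n ih =>
    ext a
    rw [lowestLevels, ih, Set.mem_union, Set.mem_ofPred_eq, Set.mem_ofPred_eq, hf.minimal_iff,
      Set.mem_ofPred_eq]
    omega

theorem IsLevelFunction.mem_levelSet_iff (hf : IsLevelFunction f) {n : ℕ} {a : P} :
    a ∈ levelSet P n ↔ f a = n := by
  rw [levelSet, Set.mem_ofPred_eq, hf.lowestLevels_eq, hf.minimal_iff]

/-- This uniqueness identifies the levels both of an abstract poset (through `Order.height`) and of
`Vertex w` (through `lev`). -/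
theorem IsLevelFunction.level_eq (hf : IsLevelFunction f) : level = f := by
  funext a
  have : {n | a ∈ levelSet P n} = {f a} := by
    ext n
    simp [hf.mem_levelSet_iff, eq_comm]
  rw [level, this, csInf_singleton]

variable (P) in
theorem isLevelFunction_level [Finite P] : IsLevelFunction (level (P := P)) := by
  have hfin : ∀ a : P, Order.height a < ⊤ := fun a => by
    have := Fintype.ofFinite P
    rw [lt_top_iff_ne_top, Ne, Order.height_eq_top_iff]
    intro h
    obtain ⟨p, -, hp⟩ := h (Fintype.card P)
    exact p.length_lt_card.ne hp
  have hcoe : ∀ a : P, ((Order.height a).toNat : ℕ∞) = Order.height a :=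
    fun a => ENat.natCast_toNat (hfin a).ne
  have h : IsLevelFunction fun a : P => (Order.height a).toNat := by
    constructor
    · intro a b hab
      have := Order.height_strictMono hab (hfin a)
      rw [← hcoe a, ← hcoe b] at this
      exact_mod_cast this
    · intro b n hb
      have h1 : Order.height b = n + 1 := by
        rw [← hcoe b]
        exact congrArg Nat.cast hb
      obtain ⟨-, ⟨a, hab, ha⟩, -⟩ := Order.height_eq_coe_add_one_iff.1 h1
      exact ⟨a, hab, by simp [ha]⟩
  rwa [h.level_eq]

end Levels

theorem exists_isPart_mem {P : Type*} [PartialOrder P] (a : P) : ∃ X : Part P, X.IsPart ∧ a ∈ X.vertices := by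
  by_cases ha : a ∈ tangleVertices P
  · obtain ⟨A, B, hAB, hmem⟩ := ha
    exact ⟨.tangle A B, hAB, hmem⟩
  · exact ⟨.cloneSet _, ⟨a, ha, rfl⟩, ha, rfl⟩

/-! ### The word of a compatible listing is supported and separated. -/

section Listings

variable {P : Type*} [PartialOrder P] [Finite P]

theorem mem_levelSet_iff {n : ℕ} {a : P} : a ∈ levelSet P n ↔ level a = n :=
  (isLevelFunction_level P).mem_levelSet_iff

theorem Part.HasLetter.level_mem {X : Part P} {x : Letter} (h : X.HasLetter x) {a : P}
    (ha : a ∈ X.vertices) : x.start ≤ level a ∧ level a < x.finish := by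
  cases X with
  | cloneSet C =>
    cases x with
    | c i =>
      have := mem_levelSet_iff.1 (h ha)
      simp only [Letter.start, Letter.finish]; omega
    | t i => exact h.elim
  | tangle A B =>
    cases x with
    | c i => exact h.elim
    | t i =>
      simp only [Letter.start, Letter.finish]
      rcases ha with ha | ha
      · have := mem_levelSet_iff.1 (h.2 ha); omega
      · have := mem_levelSet_iff.1 (h.1 ha); omega

theorem Part.HasLetter.exists_level_eq_start {X : Part P} {x : Letter} (h : X.HasLetter x)
    (hX : X.IsPart) : ∃ a ∈ X.vertices, level a = x.start := by
  cases X with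
  | cloneSet C =>
    cases x with
    | c i =>
      obtain ⟨a, ha, rfl⟩ := hX
      exact ⟨a, ⟨ha, rfl⟩, mem_levelSet_iff.1 (h ⟨ha, rfl⟩)⟩
    | t i => exact h.elim
  | tangle A B =>
    cases x with
    | c i => exact h.elim
    | t i =>
      obtain ⟨a, ha⟩ := hX.2.1.1.nonempty
      exact ⟨a, .inr ha, mem_levelSet_iff.1 (h.1 ha)⟩

/-- A vertex on the lowest level `s + 1` of its part is above some vertex on level `s`. That vertex
lies in another part, and being only one level lower it must be listed earlier. -/
theorem IsCompatibleListing.supported {L : List (Part P)} {w : List Letter}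
    (hL : IsCompatibleListing L) (hw : List.Forall₂ Part.HasLetter L w) : Supported w := by
  rintro u v y s rfl hs
  obtain ⟨hlen, hlet⟩ := List.forall₂_iff_get.1 hw
  have hj : u.length < L.length := by rw [hlen]; simp
  have hy := hlet u.length hj (by simp)
  simp only [List.get_eq_getElem, List.getElem_append_right le_rfl, Nat.sub_self,
    List.getElem_cons_zero] at hy
  obtain ⟨b, hb, hbs⟩ := hy.exists_level_eq_start ((hL.2.1 _).1 (List.getElem_mem _))
  obtain ⟨a, hab, has⟩ := (isLevelFunction_level P).2 b s (hbs.trans hs)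
  obtain ⟨X, hX, haX⟩ := exists_isPart_mem a
  obtain ⟨i, hi, rfl⟩ := List.getElem_of_mem ((hL.2.1 X).2 hX)
  have hij : i ≠ u.length := by
    rintro rfl
    have := (hy.level_mem haX).1
    omega
  have := (hL.2.2 ⟨i, hi⟩ ⟨u.length, hj⟩ (by simpa using hij) a haX b hb).1 hab
  rcases this with h | ⟨-, h⟩
  · omega
  · have hiu : i < u.length := h
    have hx := hlet i hi (hlen ▸ hi)
    simp only [List.get_eq_getElem, List.getElem_append_left hiu] at hx
    have := hx.level_mem haX
    exact ⟨u[i], List.getElem_mem _, by omega, by omega⟩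

/-- If no part listed between two clone sets on level `i` meets the levels next to `i`, every vertex
compares in the same way with both. The two sets then have the same view and coincide, against the
absence of repetitions. -/
theorem IsCompatibleListing.separated {L : List (Part P)} {w : List Letter}
    (hL : IsCompatibleListing L) (hw : List.Forall₂ Part.HasLetter L w) : Separated w := by
  rintro u v x i rfl -
  obtain ⟨hlen, hlet⟩ := List.forall₂_iff_get.1 hw
  have hmono := (isLevelFunction_level P).1
  by_contra! hdep
  have hp : u.length < L.length := by rw [hlen]; simp
  have hq : u.length + 1 + v.length < L.length := by rw [hlen]; simp; omega
  have hletp := hlet _ hp (hlen ▸ hp)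
  have hletq := hlet _ hq (hlen ▸ hq)
  have ep : (u ++ Letter.c i :: (v ++ Letter.c i :: x))[u.length]'(hlen ▸ hp) = .c i := by simp
  have eq : (u ++ Letter.c i :: (v ++ Letter.c i :: x))[u.length + 1 + v.length]'(hlen ▸ hq) =
      .c i := by
    simp [List.getElem_cons, Nat.add_assoc]
  have hbetween : ∀ r (hr : r < L.length), u.length < r → r < u.length + 1 + v.length →
      ∀ a ∈ L[r].vertices, level a + 1 ≠ i ∧ level a ≠ i + 1 := by
    intro r hr h1 h2 a ha
    have hletr := hlet r hr (hlen ▸ hr)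
    obtain ⟨k, rfl⟩ := Nat.exists_eq_add_of_lt h1
    have hk : k < v.length := by omega
    have er : (u ++ Letter.c i :: (v ++ Letter.c i :: x))[u.length + k + 1]'(hlen ▸ hr) = v[k] := by
      simp [Nat.add_assoc, hk]
    simp only [List.get_eq_getElem, er] at hletr
    have := hletr.level_mem ha
    have := hdep _ (List.getElem_mem hk)
    change ¬ (v[k].start ≤ i + 1 ∧ i ≤ v[k].finish) at this
    omega
  simp only [List.get_eq_getElem, ep] at hletp
  simp only [List.get_eq_getElem, eq] at hletq
  have hne : L[u.length] ≠ L[u.length + 1 + v.length] := by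
    intro h
    have := (List.Nodup.getElem_inj_iff hL.1).1 h
    omega
  have hXp := (hL.2.1 _).1 (List.getElem_mem hp)
  have hXq := (hL.2.1 _).1 (List.getElem_mem hq)
  generalize hX : L[u.length] = X at *
  generalize hY : L[u.length + 1 + v.length] = Y at *
  cases X with
  | tangle A B => exact hletp
  | cloneSet C =>
  cases Y with
  | tangle A B => exact hletq
  | cloneSet D =>
  obtain ⟨a, ha, rfl⟩ := hXp
  obtain ⟨b, hb, rfl⟩ := hXq
  have hla : level a = i := mem_levelSet_iff.1 (hletp ⟨ha, rfl⟩)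
  have hlb : level b = i := mem_levelSet_iff.1 (hletq ⟨hb, rfl⟩)
  suffices hab : view a = view b by
    apply hne
    simp only [Clone, hab]
  have haX : a ∈ L[u.length].vertices := by rw [hX]; exact ⟨ha, rfl⟩
  have hbY : b ∈ L[u.length + 1 + v.length].vertices := by rw [hY]; exact ⟨hb, rfl⟩
  have key : ∀ y : P, (y < a ↔ y < b) ∧ (a < y ↔ b < y) := by
    intro y
    by_cases hy : level y = i
    · have h1 : ∀ s t : P, s < t → level s ≠ level t := fun s t h => (hmono h).ne
      refine ⟨iff_of_false (fun h => h1 _ _ h ?_) (fun h => h1 _ _ h ?_),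
        iff_of_false (fun h => h1 _ _ h ?_) (fun h => h1 _ _ h ?_)⟩ <;> omega
    obtain ⟨Z, hZ, hyZ⟩ := exists_isPart_mem y
    obtain ⟨r, hr, rfl⟩ := List.getElem_of_mem ((hL.2.1 Z).2 hZ)
    have hrp : r ≠ u.length := by
      rintro rfl
      rw [hX] at hyZ
      exact hy (mem_levelSet_iff.1 (hletp hyZ))
    have hrq : r ≠ u.length + 1 + v.length := by
      rintro rfl
      rw [hY] at hyZ
      exact hy (mem_levelSet_iff.1 (hletq hyZ))
    have hb := hbetween r hr
    have c1 := hL.2.2 ⟨r, hr⟩ ⟨_, hp⟩ (by simpa using hrp) y hyZ a haX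
    have c2 := hL.2.2 ⟨r, hr⟩ ⟨_, hq⟩ (by simpa using hrq) y hyZ b hbY
    have c3 := hL.2.2 ⟨_, hp⟩ ⟨r, hr⟩ (by simpa using hrp.symm) a haX y hyZ
    have c4 := hL.2.2 ⟨_, hq⟩ ⟨r, hr⟩ (by simpa using hrq.symm) b hbY y hyZ
    rw [c1, c2, c3, c4]
    simp only [Fin.mk_lt_mk]
    by_cases hbt : u.length < r ∧ r < u.length + 1 + v.length
    · have := hb hbt.1 hbt.2 y hyZ
      omega
    · omega
  refine Prod.ext (Set.ext fun y => (key y).1) (congrArg compl (Set.ext fun y => (key y).2))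

end Listings

end ThreePlusOne

namespace ThreePlusOne

/-! ### The poset of a supported and separated word. -/

theorem Separated.exists_between {w : List Letter} (hw : Separated w) {p q i : ℕ}
    (hp : p < w.length) (hq : q < w.length) (hpq : p < q) (hwp : w[p] = .c i) (hwq : w[q] = .c i) :
    ∃ r, p < r ∧ r < q ∧ ∃ hr : r < w.length, w[r] ≠ .c i ∧ w[r].Dep (.c i) := by
  obtain ⟨v, x, hvx, hv⟩ : ∃ v x, w.drop (p + 1) = v ++ .c i :: x ∧ .c i ∉ v := by
    refine List.eq_append_cons_of_mem (List.mem_iff_getElem.2 ⟨q - (p + 1), ?_, ?_⟩)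
    · simp; omega
    · simp only [List.getElem_drop, Nat.add_sub_cancel' (Nat.succ_le_of_lt hpq), hwq]
  have hdecomp : w = w.take p ++ .c i :: (v ++ .c i :: x) := by
    rw [← hvx, ← hwp]
    simp
  obtain ⟨z, hz, hdep⟩ := hw _ v x i hdecomp hv
  obtain ⟨k, hk, rfl⟩ := List.getElem_of_mem hz
  have hget : ∀ k (hk : k < (w.drop (p + 1)).length), (w.drop (p + 1))[k] =
      w[p + 1 + k]'(by simp at hk; omega) := fun k hk => List.getElem_drop
  have hlen := congrArg List.length hvx
  simp only [List.length_drop, List.length_append, List.length_cons] at hlen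
  have hkv : w[p + 1 + k] = v[k] := by
    rw [← hget k (by simp; omega)]
    simp only [hvx, List.getElem_append_left hk]
  refine ⟨p + 1 + k, by omega, ?_, by omega, ?_, ?_⟩
  · by_contra! hle
    refine hv (List.mem_iff_getElem.2 ⟨q - (p + 1), by omega, ?_⟩)
    have h1 := hget (q - (p + 1)) (by simp; omega)
    simp only [hvx, Nat.add_sub_cancel' (Nat.succ_le_of_lt hpq), hwq] at h1
    rw [← h1, List.getElem_append_left]
  · rw [hkv]
    rintro h
    exact hv (h ▸ List.getElem_mem hk)
  · rw [hkv]
    exact hdep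

/-- The vertices of a poset whose parts correspond to the letters of `w`: four vertices for each
letter, given by its position, whether they are in the top of a tangle, and the side of a tangle
on which they lie. -/
structure Vertex (w : List Letter) where
  pos : Fin w.length
  top : Bool
  side : Bool

namespace Vertex

variable {w : List Letter}

instance : Finite (Vertex w) :=
  Finite.of_injective (fun v : Vertex w => (v.pos, v.top, v.side)) fun a b h => by
    cases a; cases b; simpa using h

/-- The letter of the part of a vertex. -/
def letter (v : Vertex w) : Letter :=
  w[v.pos]

/-- The level of a vertex. -/
def lev (v : Vertex w) : ℕ :=
  match v.letter with
  | .c i => i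
  | .t i => i + v.top.toNat

theorem lev_of_c {v : Vertex w} {i : ℕ} (h : v.letter = .c i) : v.lev = i := by
  simp [lev, h]

theorem lev_of_t {v : Vertex w} {i : ℕ} (h : v.letter = .t i) : v.lev = i + v.top.toNat := by
  simp [lev, h]

theorem lev_mk_of_c {k : Fin w.length} {i : ℕ} (h : w[k] = .c i) (e s : Bool) :
    lev (⟨k, e, s⟩ : Vertex w) = i :=
  lev_of_c h

theorem lev_mk_of_t {k : Fin w.length} {i : ℕ} (h : w[k] = .t i) (e s : Bool) :
    lev (⟨k, e, s⟩ : Vertex w) = i + e.toNat :=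
  lev_of_t h

theorem letter_congr {a b : Vertex w} (h : a.pos = b.pos) : a.letter = b.letter := by
  simp [letter, h]

/-- Between positions this is the order forced by a compatible listing. Within a position, c gives
an antichain of clones and t a `(2+2)` with one chain on each side. Transitivity is immediate, since
two strict steps raise the level by at least 2. -/
instance : PartialOrder (Vertex w) where
  le a b := a = b ∨ a.lev + 2 ≤ b.lev ∨
    (a.lev + 1 = b.lev ∧ (a.pos < b.pos ∨ (a.pos = b.pos ∧ a.side = b.side)))
  lt a b := a.lev + 2 ≤ b.lev ∨
    (a.lev + 1 = b.lev ∧ (a.pos < b.pos ∨ (a.pos = b.pos ∧ a.side = b.side)))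
  le_refl a := .inl rfl
  le_trans a b c := by
    rintro (rfl | h) (rfl | h')
    · exact .inl rfl
    · exact .inr h'
    · exact .inr h
    · right; left; omega
  le_antisymm a b := by
    rintro (rfl | h) (h' | h')
    · rfl
    · rfl
    · exact h'.symm
    · omega
  lt_iff_le_not_ge a b := by
    constructor
    · intro h
      refine ⟨.inr h, ?_⟩
      rintro (rfl | h')
      · omega
      · omega
    · rintro ⟨rfl | h, h'⟩
      · exact absurd (.inl rfl) h'
      · exact h

theorem lt_iff {a b : Vertex w} : a < b ↔ a.lev + 2 ≤ b.lev ∨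
    (a.lev + 1 = b.lev ∧ (a.pos < b.pos ∨ (a.pos = b.pos ∧ a.side = b.side))) :=
  Iff.rfl

theorem lev_strictMono : StrictMono (lev (w := w)) := fun a b h => by
  rw [lt_iff] at h
  omega

theorem le_iff {a b : Vertex w} : a ≤ b ↔ a = b ∨ a < b :=
  Iff.rfl

theorem lev_eq_of_pos_eq_of_top_eq {a b : Vertex w} (h : a.pos = b.pos) (ht : a.top = b.top) :
    a.lev = b.lev := by
  simp only [lev, letter_congr h, ht]

theorem lev_le_succ_of_pos_eq {a b : Vertex w} (h : a.pos = b.pos) : a.lev ≤ b.lev + 1 := by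
  cases hl : b.letter with
  | c i => rw [lev_of_c hl, lev_of_c ((letter_congr h).trans hl)]; omega
  | t i =>
    rw [lev_of_t hl, lev_of_t ((letter_congr h).trans hl)]
    have := Bool.toNat_le a.top
    omega

/-- Incomparability with `a` and `c` forces `d` onto level `a.lev + 1`, with `c` on `a.lev + 2`.
Then `c.pos ≤ d.pos ≤ a.pos ≤ b.pos ≤ c.pos`, but a single position spans at most two levels. -/
theorem isThreePlusOneFree : IsThreePlusOneFree (Vertex w) := by
  rintro a b c d hab hbc ⟨h1, h2, h3⟩
  have hac := lev_le_succ_of_pos_eq (a := c) (b := a)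
  have e1 : ¬ a < d := fun h => h1.2 h.le
  have e2 : ¬ d < c := fun h => h3.1 h.le
  have e3 : ¬ d < a := fun h => h1.1 h.le
  have e4 : ¬ c < d := fun h => h3.2 h.le
  rw [lt_iff] at hab hbc e1 e2 e3 e4
  omega

/-- For a supported word, `lev` is the level function. -/
theorem isLevelFunction_lev (hw : Supported w) : IsLevelFunction (lev (w := w)) := by
  refine ⟨lev_strictMono, fun b n hb => ?_⟩
  -- A tangle top has the bottom vertex on its own side below it. In all other cases `b` is on the
  -- starting level of its letter, and support applies.
  by_cases ht : b.letter = .t n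
  · have htop : b.top = true := by
      rw [lev_of_t ht] at hb
      cases h : b.top <;> simp [h] at hb ⊢
    refine ⟨⟨b.pos, false, b.side⟩, ?_, ?_⟩
    · rw [lt_iff, lev_mk_of_t (i := n) ht]
      exact .inr ⟨hb.symm, .inr ⟨rfl, rfl⟩⟩
    · rw [lev_mk_of_t (i := n) ht]; rfl
  · have hstart : b.letter.start = n + 1 := by
      cases hl : b.letter with
      | c i => rw [lev_of_c hl] at hb; exact hb
      | t i =>
        rw [lev_of_t hl] at hb
        cases h : b.top <;> simp [h] at hb
        · exact hb
        · exact absurd (hb ▸ hl) ht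
    obtain ⟨z, hz, h1, h2⟩ := hw (w.take b.pos) (w.drop (b.pos + 1)) b.letter n
      (by simp [letter]) hstart
    obtain ⟨k, hk, rfl⟩ := List.getElem_of_mem hz
    have hkb : k < b.pos := by simp at hk; omega
    have hkw : k < w.length := by omega
    rw [List.getElem_take] at h1 h2
    have : ∃ a : Vertex w, a.pos = ⟨k, hkw⟩ ∧ a.lev = n := by
      cases hl : w[k] with
      | c i =>
        rw [hl] at h1 h2
        simp only [Letter.start, Letter.finish] at h1 h2
        exact ⟨⟨⟨k, hkw⟩, false, false⟩, rfl, by rw [lev_mk_of_c (i := i) hl]; omega⟩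
      | t i =>
        rw [hl] at h1 h2
        simp only [Letter.start, Letter.finish] at h1 h2
        by_cases hi : i = n
        · exact ⟨⟨⟨k, hkw⟩, false, false⟩, rfl, by rw [lev_mk_of_t (i := i) hl]; simpa⟩
        · exact ⟨⟨⟨k, hkw⟩, true, false⟩, rfl, by rw [lev_mk_of_t (i := i) hl]; simp; omega⟩
    obtain ⟨a, hap, han⟩ := this
    refine ⟨a, lt_iff.2 (.inr ⟨by omega, .inl ?_⟩), han⟩
    rw [hap]
    exact hkb

/-- The part at position `k`. -/
def part (k : Fin w.length) : Part (Vertex w) :=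
  match w[k] with
  | .c _ => .cloneSet {v | v.pos = k}
  | .t _ => .tangle {v | v.pos = k ∧ v.top = true} {v | v.pos = k ∧ v.top = false}

theorem vertices_part (k : Fin w.length) : (part k).vertices = {v | v.pos = k} := by
  unfold part
  split
  · rfl
  · ext v
    cases h : v.top <;> simp [Part.vertices, h]

theorem part_injective : Function.Injective (part (w := w)) := by
  intro k l h
  have h1 := congrArg Part.vertices h
  rw [vertices_part, vertices_part] at h1
  have : (⟨k, false, false⟩ : Vertex w) ∈ {v : Vertex w | v.pos = l} := h1 ▸ rfl
  exact this

/-- Downsets grow with the level and, on one level, with the position. They can be incomparable only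
at equal positions, where the side distinguishes them. -/
theorem topGraph_adj {a b : Vertex w} : (topGraph (Vertex w)).Adj a b ↔
    a.pos = b.pos ∧ (∃ i, a.letter = .t i) ∧ a.top = true ∧ b.top = true ∧ a.side ≠ b.side := by
  constructor
  · rintro ⟨h1, h2⟩
    obtain ⟨c, hca, hcb⟩ := Set.not_subset.1 h1
    obtain ⟨d, hdb, hda⟩ := Set.not_subset.1 h2
    simp only [Set.mem_Iio, lt_iff] at hca hcb hdb hda
    have hlev : a.lev = b.lev := by omega
    have hc : c.pos = a.pos ∧ c.side = a.side := by grind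
    have hd : d.pos = b.pos ∧ d.side = b.side := by grind
    have hpos : a.pos = b.pos := by omega
    have hside : a.side ≠ b.side := by grind
    have hcl : c.lev < a.lev := by omega
    cases hl : a.letter with
    | c i =>
      rw [lev_of_c hl, lev_of_c ((letter_congr hc.1).trans hl)] at hcl
      omega
    | t i =>
      rw [lev_of_t hl, lev_of_t ((letter_congr hc.1).trans hl)] at hcl
      rw [lev_of_t hl, lev_of_t ((letter_congr hpos.symm).trans hl)] at hlev
      refine ⟨hpos, ⟨i, rfl⟩, ?_, ?_, hside⟩
      · cases h : a.top <;> simp [h] at hcl ⊢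
      · cases h : a.top <;> cases h' : b.top <;> simp [h, h'] at hcl hlev ⊢
  · rintro ⟨hpos, ⟨i, hl⟩, hat, hbt, hside⟩
    have key : ∀ {a b : Vertex w}, a.pos = b.pos → a.letter = .t i → a.top = true →
        b.top = true → a.side ≠ b.side → ¬ Set.Iio a ⊆ Set.Iio b := by
      intro a b hpos hl hat hbt hside h
      have hla := lev_of_t hl
      have hlb := lev_of_t ((letter_congr hpos.symm).trans hl)
      have hlc : lev (w := w) ⟨a.pos, false, a.side⟩ = i := by
        rw [lev_mk_of_t (i := i) hl]; rfl
      simp only [hat, hbt, Bool.toNat_true] at hla hlb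
      have hca : (⟨a.pos, false, a.side⟩ : Vertex w) ∈ Set.Iio a := by
        simp only [Set.mem_Iio, lt_iff, hlc, hla]
        simp
      have := h hca
      simp only [Set.mem_Iio, lt_iff, hlc, hlb] at this
      simp [hside, hpos] at this
    exact ⟨key hpos hl hat hbt hside,
      key hpos.symm ((letter_congr hpos.symm).trans hl) hbt hat hside.symm⟩

theorem botGraph_adj {a b : Vertex w} : (botGraph (Vertex w)).Adj a b ↔
    a.pos = b.pos ∧ (∃ i, a.letter = .t i) ∧ a.top = false ∧ b.top = false ∧ a.side ≠ b.side := by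
  constructor
  · rintro ⟨h1, h2⟩
    obtain ⟨c, hca, hcb⟩ := Set.not_subset.1 h1
    obtain ⟨d, hdb, hda⟩ := Set.not_subset.1 h2
    simp only [Set.mem_Ioi, lt_iff] at hca hcb hdb hda
    have hlev : a.lev = b.lev := by omega
    have hc : a.pos = c.pos ∧ a.side = c.side := by grind
    have hd : b.pos = d.pos ∧ b.side = d.side := by grind
    have hpos : a.pos = b.pos := by omega
    have hside : a.side ≠ b.side := by grind
    have hcl : a.lev < c.lev := by omega
    cases hl : a.letter with
    | c i =>
      rw [lev_of_c hl, lev_of_c ((letter_congr hc.1.symm).trans hl)] at hcl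
      omega
    | t i =>
      rw [lev_of_t hl, lev_of_t ((letter_congr hc.1.symm).trans hl)] at hcl
      rw [lev_of_t hl, lev_of_t ((letter_congr hpos.symm).trans hl)] at hlev
      have := Bool.toNat_le c.top
      refine ⟨hpos, ⟨i, rfl⟩, ?_, ?_, hside⟩
      · cases h : a.top <;> simp [h] at hcl ⊢
        omega
      · cases h : a.top <;> cases h' : b.top <;> simp [h, h'] at hcl hlev ⊢
        omega
  · rintro ⟨hpos, ⟨i, hl⟩, hat, hbt, hside⟩
    have key : ∀ {a b : Vertex w}, a.pos = b.pos → a.letter = .t i → a.top = false →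
        b.top = false → a.side ≠ b.side → ¬ Set.Ioi a ⊆ Set.Ioi b := by
      intro a b hpos hl hat hbt hside h
      have hla := lev_of_t hl
      have hlb := lev_of_t ((letter_congr hpos.symm).trans hl)
      have hlc : lev (w := w) ⟨a.pos, true, a.side⟩ = i + 1 := by
        rw [lev_mk_of_t (i := i) hl]; rfl
      simp only [hat, hbt, Bool.toNat_false, add_zero] at hla hlb
      have hca : (⟨a.pos, true, a.side⟩ : Vertex w) ∈ Set.Ioi a := by
        simp only [Set.mem_Ioi, lt_iff, hlc, hla]
        simp
      have := h hca
      simp only [Set.mem_Ioi, lt_iff, hlc, hlb] at this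
      simp [hside.symm, hpos] at this
    exact ⟨key hpos hl hat hbt hside,
      key hpos.symm ((letter_congr hpos.symm).trans hl) hbt hat hside.symm⟩

/-- The nontrivial components of a graph that joins the two vertices of a top or bottom row. -/
theorem exists_component_iff {G : SimpleGraph (Vertex w)} {e : Bool}
    (hG : ∀ a b, G.Adj a b ↔ a.pos = b.pos ∧ (∃ i, a.letter = .t i) ∧ a.top = e ∧ b.top = e ∧
      a.side ≠ b.side) (A : Set (Vertex w)) :
    (A.Nontrivial ∧ ∃ C : G.ConnectedComponent, C.supp = A) ↔
      ∃ k : Fin w.length, (∃ i, w[k] = .t i) ∧ A = {v | v.pos = k ∧ v.top = e} := by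
  have ext' : ∀ {a b : Vertex w}, a.pos = b.pos → a.top = b.top → a.side = b.side → a = b := by
    rintro ⟨⟩ ⟨⟩ h1 h2 h3
    simp_all
  -- Every edge switches between two sides, so a walk of two edges returns to its start.
  have hreach : ∀ a b, G.Reachable a b ↔ a = b ∨ G.Adj a b := by
    refine fun a b => ⟨fun h => ?_, ?_⟩
    · rw [SimpleGraph.reachable_iff_reflTransGen] at h
      induction h with
      | refl => exact .inl rfl
      | @tail b c _ hbc ih =>
        rcases ih with rfl | hab
        · exact .inr hbc
        · left
          rw [hG] at hab hbc
          refine ext' (hab.1.trans hbc.1) (hab.2.2.1.trans hbc.2.2.2.1.symm) ?_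
          have h1 := hab.2.2.2.2
          have h2 := hbc.2.2.2.2
          revert h1 h2
          cases a.side <;> cases b.side <;> cases c.side <;> simp
    · rintro (rfl | h)
      · rfl
      · exact h.reachable
  have hsupp : ∀ k : Fin w.length, (∃ i, w[k] = .t i) → ∀ s : Bool,
      (G.connectedComponentMk ⟨k, e, s⟩).supp = {v | v.pos = k ∧ v.top = e} := by
    intro k hk s
    ext v
    rw [SimpleGraph.ConnectedComponent.mem_supp_iff, SimpleGraph.ConnectedComponent.eq, hreach, hG]
    constructor
    · rintro (rfl | h)
      · exact ⟨rfl, rfl⟩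
      · exact ⟨h.1, h.2.2.1⟩
    · rintro ⟨rfl, rfl⟩
      by_cases hs : v.side = s
      · exact .inl (ext' rfl rfl hs)
      · exact .inr ⟨rfl, hk, rfl, rfl, hs⟩
  constructor
  · rintro ⟨⟨a, ha, b, hb, hne⟩, C, rfl⟩
    rw [SimpleGraph.ConnectedComponent.mem_supp_iff] at ha hb
    have hab := ((hreach a b).1 (SimpleGraph.ConnectedComponent.eq.1 (ha.trans hb.symm))).resolve_left
      hne
    rw [hG] at hab
    refine ⟨a.pos, hab.2.1, ?_⟩
    rw [← hsupp a.pos hab.2.1 a.side, ← ha, ← hab.2.2.1]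
  · rintro ⟨k, hk, rfl⟩
    refine ⟨⟨⟨k, e, false⟩, ⟨rfl, rfl⟩, ⟨k, e, true⟩, ⟨rfl, rfl⟩, by simp⟩, _, hsupp k hk false⟩

theorem isTangleTop_iff (A : Set (Vertex w)) : IsTangleTop A ↔
    ∃ k : Fin w.length, (∃ i, w[k] = .t i) ∧ A = {v | v.pos = k ∧ v.top = true} :=
  exists_component_iff (fun _ _ => topGraph_adj) A

theorem isTangleBottom_iff (B : Set (Vertex w)) : IsTangleBottom B ↔
    ∃ k : Fin w.length, (∃ i, w[k] = .t i) ∧ B = {v | v.pos = k ∧ v.top = false} :=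
  exists_component_iff (fun _ _ => botGraph_adj) B

theorem isTangle_iff (A B : Set (Vertex w)) : IsTangle A B ↔
    ∃ k : Fin w.length, (∃ i, w[k] = .t i) ∧ A = {v | v.pos = k ∧ v.top = true} ∧
      B = {v | v.pos = k ∧ v.top = false} := by
  constructor
  · rintro ⟨hA, hB, a, ha, b, hb, c, hc, d, hd, hca, -, -, -, had, -⟩
    obtain ⟨k, hk, rfl⟩ := (isTangleTop_iff A).1 hA
    obtain ⟨l, hl, rfl⟩ := (isTangleBottom_iff B).1 hB
    refine ⟨k, hk, rfl, ?_⟩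
    suffices l = k by rw [this]
    -- The vertices `c` and `d` share position and level, so at another position than theirs `a` is
    -- above both or neither.
    by_contra hne
    refine had.2 (le_of_lt ?_)
    have hcd := lev_eq_of_pos_eq_of_top_eq (hc.1.trans hd.1.symm) (hc.2.trans hd.2.symm)
    have h1 := hc.1
    have h2 := hd.1
    have h3 := ha.1
    rw [lt_iff] at hca ⊢
    rw [← hcd, h2, ← h1]
    rw [h1, h3] at hca ⊢
    omega
  · rintro ⟨k, ⟨i, hk⟩, rfl, rfl⟩
    refine ⟨(isTangleTop_iff _).2 ⟨k, ⟨i, hk⟩, rfl⟩, (isTangleBottom_iff _).2 ⟨k, ⟨i, hk⟩, rfl⟩,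
      ⟨k, true, false⟩, ⟨rfl, rfl⟩, ⟨k, true, true⟩, ⟨rfl, rfl⟩, ⟨k, false, false⟩, ⟨rfl, rfl⟩,
      ⟨k, false, true⟩, ⟨rfl, rfl⟩, ?_⟩
    have hlev : ∀ e s, lev (w := w) ⟨k, e, s⟩ = i + e.toNat := fun e s => lev_of_t hk
    simp [IsTwoPlusTwo, IncompRel, le_iff, lt_iff, hlev]
    omega

theorem mem_tangleVertices_iff (v : Vertex w) :
    v ∈ tangleVertices (Vertex w) ↔ ∃ i, v.letter = .t i := by
  constructor
  · rintro ⟨A, B, hAB, hv⟩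
    obtain ⟨k, hk, rfl, rfl⟩ := (isTangle_iff A B).1 hAB
    rcases hv with ⟨rfl, -⟩ | ⟨rfl, -⟩ <;> exact hk
  · intro h
    refine ⟨_, _, (isTangle_iff _ _).2 ⟨v.pos, h, rfl, rfl⟩, ?_⟩
    cases ht : v.top <;> simp [ht]

/-- Support makes clones have equal levels. Two different positions of c_i are then told apart by a
vertex between them on level `i - 1` or `i + 1`, which separation provides. -/
theorem clone_iff (hs : Supported w) (hw : Separated w) {a b : Vertex w} {i j : ℕ}
    (ha : a.letter = .c i) (hb : b.letter = .c j) : Clone a b ↔ a.pos = b.pos := by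
  have hla := lev_of_c ha
  have hlb := lev_of_c hb
  constructor
  · intro h
    obtain ⟨h1, h2⟩ := Prod.ext_iff.1 h
    have hlt : ∀ x, x < a ↔ x < b := fun x => Set.ext_iff.1 h1 x
    have hgt : ∀ x, a < x ↔ b < x := fun x => Set.ext_iff.1 (compl_injective h2) x
    have hlf := isLevelFunction_lev hs
    have hij : i = j := by
      by_contra hne
      rcases Nat.lt_or_gt_of_ne hne with h | h
      · obtain ⟨x, hx, hxl⟩ := hlf.exists_lt (b := b) (n := i) (by omega)
        have := lev_strictMono ((hlt x).2 hx)
        omega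
      · obtain ⟨x, hx, hxl⟩ := hlf.exists_lt (b := a) (n := j) (by omega)
        have := lev_strictMono ((hlt x).1 hx)
        omega
    subst hij
    have key : ∀ {a b : Vertex w}, (∀ x, x < a ↔ x < b) → (∀ x, a < x ↔ b < x) →
        a.letter = .c i → b.letter = .c i → ¬ a.pos < b.pos := by
      intro a b hlt hgt ha hb hab
      have hla := lev_of_c ha
      have hlb := lev_of_c hb
      obtain ⟨r, h1, h2, hr, hne, hdep⟩ := hw.exists_between a.pos.2 b.pos.2 hab ha hb
      -- Every letter dependent on c_i and different from it meets a level next to `i`; for a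
      -- tangle, `e` selects its top or its bottom.
      obtain ⟨e, he⟩ : ∃ e, lev (⟨⟨r, hr⟩, e, false⟩ : Vertex w) = i + 1 ∨
          lev (⟨⟨r, hr⟩, e, false⟩ : Vertex w) + 1 = i := by
        cases hl : w[r] with
        | c j =>
          simp only [hl, Letter.Dep, Letter.start, Letter.finish, ne_eq, Letter.c.injEq] at hne hdep
          simp only [lev_mk_of_c (w := w) (k := ⟨r, hr⟩) hl]
          exact ⟨false, by omega⟩
        | t j =>
          simp only [hl, Letter.Dep, Letter.start, Letter.finish] at hdep
          simp only [lev_mk_of_t (w := w) (k := ⟨r, hr⟩) hl, Bool.exists_bool, Bool.toNat_false,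
            Bool.toNat_true]
          omega
      have hlt := hlt ⟨⟨r, hr⟩, e, false⟩
      have hgt := hgt ⟨⟨r, hr⟩, e, false⟩
      simp only [lt_iff, hla, hlb, Fin.lt_def, Fin.ext_iff] at hlt hgt
      rcases he with he | he
      · have := hgt.1 (.inr ⟨he.symm, .inl h1⟩)
        omega
      · have := hlt.2 (.inr ⟨he, .inl h2⟩)
        omega
    refine le_antisymm (not_lt.1 ?_) (not_lt.1 ?_)
    · exact key (fun x => (hlt x).symm) (fun x => (hgt x).symm) hb ha
    · exact key hlt hgt ha hb
  · intro h
    have hlev : a.lev = b.lev := by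
      rw [letter_congr h, hb] at ha
      cases ha
      omega
    have hpos : ∀ x : Vertex w, x.pos = b.pos → x.lev = b.lev := fun x hx => by
      rw [hlb, lev_of_c ((letter_congr hx).trans hb)]
    refine Prod.ext (Set.ext fun x => ?_) (congrArg compl (Set.ext fun x => ?_))
    · change x < a ↔ x < b
      simp only [lt_iff, h, hlev]
      have := hpos x
      constructor <;> intro <;> omega
    · change a < x ↔ b < x
      simp only [lt_iff, h, hlev]
      have := hpos x
      constructor <;> intro <;> omega

theorem isPart_iff (hs : Supported w) (hw : Separated w) (X : Part (Vertex w)) :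
    X.IsPart ↔ ∃ k, part k = X := by
  have hclone : ∀ (v : Vertex w) (i : ℕ), v.letter = .c i →
      {b | b ∉ tangleVertices (Vertex w) ∧ Clone v b} = {b | b.pos = v.pos} := by
    intro v i hv
    ext b
    simp only [Set.mem_ofPred_eq, mem_tangleVertices_iff]
    constructor
    · rintro ⟨hb, hvb⟩
      cases hl : b.letter with
      | c j => exact ((clone_iff hs hw hv hl).1 hvb).symm
      | t j => exact absurd ⟨j, hl⟩ hb
    · intro h
      have hb : b.letter = .c i := (letter_congr h).trans hv
      exact ⟨by simp [hb], (clone_iff hs hw hv hb).2 h.symm⟩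
  constructor
  · cases X with
    | cloneSet C =>
      rintro ⟨v, hv, rfl⟩
      rw [mem_tangleVertices_iff] at hv
      cases hl : v.letter with
      | c i =>
        refine ⟨v.pos, ?_⟩
        rw [hclone v i hl]
        have hl' : w[v.pos] = .c i := hl
        simp only [part, hl']
      | t i => exact absurd ⟨i, hl⟩ hv
    | tangle A B =>
      intro h
      obtain ⟨k, ⟨i, hk⟩, rfl, rfl⟩ := (isTangle_iff A B).1 h
      exact ⟨k, by simp only [part, hk]⟩
  · rintro ⟨k, rfl⟩
    cases hk : w[k] with
    | c i =>
      simp only [part, hk]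
      have hv : (⟨k, false, false⟩ : Vertex w).letter = .c i := hk
      refine ⟨⟨k, false, false⟩, ?_, (hclone _ i hv).symm⟩
      simp [mem_tangleVertices_iff, hv]
    | t i =>
      simp only [part, hk]
      exact (isTangle_iff _ _).2 ⟨k, ⟨i, hk⟩, rfl, rfl⟩

theorem hasLetter_part (hs : Supported w) (k : Fin w.length) : (part k).HasLetter w[k] := by
  have hf := isLevelFunction_lev hs
  cases hk : w[k] with
  | c i =>
    simp only [part, hk]
    rintro v rfl
    exact hf.mem_levelSet_iff.2 (lev_of_c hk)
  | t i =>
    simp only [part, hk]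
    refine ⟨?_, ?_⟩ <;> rintro v ⟨rfl, hv⟩ <;>
      exact hf.mem_levelSet_iff.2 ((lev_of_t hk).trans (by rw [hv]; rfl))

theorem isCompatibleListing (hs : Supported w) (hw : Separated w) :
    IsCompatibleListing (List.ofFn (part (w := w))) := by
  refine ⟨List.nodup_ofFn.2 part_injective, fun X => ?_, fun i j hij a ha b hb => ?_⟩
  · rw [isPart_iff hs hw, List.mem_ofFn]
  · rw [List.get_ofFn, vertices_part] at ha hb
    have hai : (a.pos : ℕ) = i := congrArg Fin.val ha
    have hbj : (b.pos : ℕ) = j := congrArg Fin.val hb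
    rw [(isLevelFunction_lev hs).level_eq, lt_iff, Fin.lt_def, Fin.lt_def, hai, hbj, Fin.ext_iff,
      hai, hbj]
    rw [Ne, Fin.ext_iff] at hij
    simp [hij]

theorem isSkeletonOf (hs : Supported w) (hw : Separated w) :
    IsSkeletonOf (Vertex w) (trace w) := by
  refine ⟨_, w, isCompatibleListing hs hw, List.forall₂_iff_get.2 ⟨by simp, fun k h₁ h₂ => ?_⟩, rfl⟩
  simpa using hasLetter_part hs ⟨k, h₂⟩

end Vertex

end ThreePlusOne

namespace ThreePlusOne

/-! ### Characterisation of skeleta and the bijection. -/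

theorem mem_skeleta_iff (m : TraceMonoid) :
    m ∈ skeleta ↔ ∃ w, Supported w ∧ Separated w ∧ trace w = m := by
  constructor
  · rintro ⟨P, _, _, -, L, w, hL, hw, rfl⟩
    exact ⟨w, hL.supported hw, hL.separated hw, rfl⟩
  · rintro ⟨w, hs, hw, rfl⟩
    exact ⟨Vertex w, inferInstance, inferInstance, Vertex.isThreePlusOneFree,
      Vertex.isSkeletonOf hs hw⟩

/-- The lexicographically maximal representative of a skeleton can be
drawn as a path without up, down, up. -/
theorem exists_lexMax_of_mem_skeleta {m : TraceMonoid} (hm : m ∈ skeleta) :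
    ∃ w, IsLexMaxRepresentative w m ∧ Drawable 0 w ∧ draw 0 w ∈ dyckPaths := by
  obtain ⟨w, hs, hw, rfl⟩ := (mem_skeleta_iff m).1 hm
  obtain ⟨w₀, h₀⟩ := exists_isLexMaxRepresentative w
  have hd := hs.drawable h₀
  refine ⟨w₀, h₀, hd, isDecoratedDyckPath_iff.2 hd.draws.dyckFrom, ?_⟩
  rw [hd.draws.up_down_up_iff]
  rintro ⟨u, v, i, rfl⟩
  have h1 : trace (u ++ .c i :: .c i :: v) = trace w := h₀.1
  exact hw.not_adjacent h1.symm

theorem exists_drawable_of_mem_dyckPaths {p : List Step} (hp : p ∈ dyckPaths) :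
    ∃ w, trace w ∈ skeleta ∧ Drawable 0 w ∧ draw 0 w = p := by
  have hd := (isDecoratedDyckPath_iff.1 hp.1).draws
  refine ⟨_, (mem_skeleta_iff _).2 ⟨_, hd.drawable.supported, hd.drawable.separated ?_, rfl⟩,
    hd.drawable, hd.eq_draw.symm⟩
  exact fun u v i h => hp.2 (hd.up_down_up_iff.2 ⟨u, v, i, h⟩)

end ThreePlusOne

open ThreePlusOne in
theorem mainTheorem10 :
    ∃ Φ : ThreePlusOne.skeleta ≃ ThreePlusOne.dyckPaths,
      ∀ m : ThreePlusOne.skeleta, ∃ w : List ThreePlusOne.Letter,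
        ThreePlusOne.IsLexMaxRepresentative w (m : ThreePlusOne.TraceMonoid) ∧
          ThreePlusOne.Draws 0 w (Φ m : List ThreePlusOne.Step) := by
  choose word hmax hdraw hmem using fun m : skeleta => exists_lexMax_of_mem_skeleta m.2
  let f : skeleta → dyckPaths := fun m => ⟨draw 0 (word m), hmem m⟩
  have hf : Function.Bijective f := by
    constructor
    · intro m m' h
      have hp : draw 0 (word m) = draw 0 (word m') := congrArg Subtype.val h
      have hw : word m = word m' := by
        -- The path determines the word read off it, and hence the trace.
        rw [← (hdraw m).draws.readWord_eq, hp, (hdraw m').draws.readWord_eq]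
      have h1 : trace (word m) = m := (hmax m).1
      have h2 : trace (word m') = m' := (hmax m').1
      exact Subtype.ext (by rw [← h1, ← h2, hw])
    · rintro ⟨p, hp⟩
      obtain ⟨w, hw, hd, rfl⟩ := exists_drawable_of_mem_dyckPaths hp
      refine ⟨⟨trace w, hw⟩, Subtype.ext ?_⟩
      change draw 0 (word ⟨trace w, hw⟩) = draw 0 w
      -- The chosen word and the drawable `w` are both greatest in the same set of representatives.
      rw [(hmax ⟨trace w, hw⟩).unique hd.isLexMaxRepresentative]
  exact ⟨Equiv.ofBijective f hf, fun m => ⟨word m, hmax m, (hdraw m).draws⟩⟩
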